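/- Let $0<\mu<L$, $R_x>0$, $N\in\mathbb{N}$ (with $N=0$ allowed), put $q=\mu/L$, and define $$\lambda_0=\sqrt{q},\qquad \lambda_{i+1}=\frac{1-\sqrt{q-(1-q)\lambda_i^2}}{1+\lambda_i^2}\,\lambda_i,\quad i=0,1,\dots$$ For $d\in\mathbb{N}$ let $\mathcal{F}(\mathbb{R}^d)$ be the set of problem instances $(\mathcal{O}_f,x_0)$ for which $f:\mathbb{R}^d\to\mathbb{R}$ is $\mu$-strongly convex and continuously differentiable with $L$-Lipschitz gradient (Euclidean norm), $\mathcal{O}_f(x)=(f(x),\nabla f(x))$ is its first-order oracle, and $\|x_*-x_0\|\le R_x$ for some $x_*\in X_*(f)$, the set of minimizers of $f$. Let $\mathcal{A}_N$ be the set of deterministic first-order methods, which receive $x_0$, make at most $N$ (adaptively chosen) calls to the oracle, and return a point $A(\mathcal{O}_f,x_0)$. Put $$\chi(A;\mathcal{F}(\mathbb{R}^d))=\sup_{(\mathcal{O}_f,x_0)\in\mathcal{F}(\mathbb{R}^d)}\ \inf_{x_*\in X_*(f)}\|A(\mathcal{O}_f,x_0)-x_*\|\in[0,\infty],$$ and let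 the minimax error be $\mathcal{E}_N(\mathbb{R}^d)=\inf_{A\in\mathcal{A}_N}\chi(A;\mathcal{F}(\mathbb{R}^d))$. The Information-Theoretic Exact Method (ITEM) with $N$ oracle calls sets $A_0=0$, $z_0=x_0$, for $k=0,\dots,N-1$ computes $$A_{k+1}=\frac{(1+q)A_k+2\bigl(1+\sqrt{(1+A_k)(1+qA_k)}\bigr)}{(1-q)^2},\quad \beta_k=\frac{A_k}{(1-q)A_{k+1}},\quad \delta_k=\frac{(1-q)^2A_{k+1}-(1+q)A_k}{2(1+q+qA_k)},$$ $$y_k=(1-\beta_k)z_k+\beta_kx_k,\quad x_{k+1}=y_k-\tfrac1L\nabla f(y_k),\quad z_{k+1}=(1-q\delta_k)z_k+q\delta_ky_k-\tfrac{\delta_k}{L}\nabla f(y_k),$$ and returns $z_N$. Then: 1. $q-(1-q)\lambda_i^2\ge 0$ for all $i\ge 0$, so that the sequence is well defined. 2. $\displaystyle \mathcal{E}_N(\mathbb{R}^{2N+1})\ \ge\ \frac{\lambda_N R_x}{\sqrt{\mu/L}}.$ 3. This is matched by ITEM: for every $d\in\mathbb{N}$, ITEM with $N$ oracle calls satisfies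 $\chi(\mathrm{ITEM};\mathcal{F}(\mathbb{R}^d))\le \lambda_N R_x/\sqrt{\mu/L}$. Hence $\mathcal{E}_N(\mathbb{R}^{2N+1})=\lambda_N R_x/\sqrt{\mu/L}$. 4. Consequently the oracle complexity is exact: if $\varepsilon\in\mathbb{R}$ is such that $N$ is the least $n$ with $\lambda_nR_x/\sqrt{\mu/L}\le\varepsilon$, then $\min\{n:\mathcal{E}_n(\mathbb{R}^{2N+1})\le\varepsilon\}=N$. -/

import Mathlib

open scoped ENNReal

/-- The computation of a deterministic first-order method that performs at most `N` oracle calls: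
it either outputs an approximate solution, or calls the oracle at a point `x` and continues
depending on the function value and gradient it is given. -/
inductive FirstOrderProc (E : Type) : ℕ → Type where
  | output {N : ℕ} (ξ : E) : FirstOrderProc E N
  | query {N : ℕ} (x : E) (next : ℝ → E → FirstOrderProc E N) : FirstOrderProc E (N + 1)

/-- The point returned when the oracle calls are answered by `O`. -/
def FirstOrderProc.run {E : Type} (O : E → ℝ × E) : {N : ℕ} → FirstOrderProc E N → E
  | _, .output ξ => ξ
  | _, .query x next => (next (O x).1 (O x).2).run O

/-- Deterministic first-order methods performing at most `N` oracle calls. A method is given a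
starting point; otherwise it accesses the objective only through the oracle. -/
abbrev FirstOrderMethod (E : Type) (N : ℕ) : Type := E → FirstOrderProc E N

noncomputable section

variable {E : Type} [NormedAddCommGroup E] [InnerProductSpace ℝ E] [CompleteSpace E]

/-- The first-order oracle of `f`. -/
def firstOrderOracle (f : E → ℝ) (x : E) : ℝ × E := (f x, gradient f x)

/-- The approximate solution produced by the method `A` on the problem instance `(O_f, x₀)`. -/
def FirstOrderMethod.apply {N : ℕ} (A : FirstOrderMethod E N) (f : E → ℝ) (x₀ : E) : E :=
  (A x₀).run (firstOrderOracle f)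

/-- The set of optimal solutions of the minimization of `f`. -/
def solutionSet (f : E → ℝ) : Set E := {x | IsMinOn f Set.univ x}

/-- The `μ`-strongly convex functions in `C^{1,1}_L(E)`. -/
def IsSmoothStronglyConvex (μ L : ℝ) (f : E → ℝ) : Prop :=
  StrongConvexOn Set.univ μ f ∧ ContDiff ℝ 1 f ∧
    ∀ x y : E, ‖gradient f x - gradient f y‖ ≤ L * ‖x - y‖

/-- The problem instances `(O_f, x₀)`, recorded as `(f, x₀)`, with `f` a `μ`-strongly convex
function in `C^{1,1}_L` and `x₀` at distance at most `R` from some optimal solution. -/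
def problemClass (E : Type) [NormedAddCommGroup E] [InnerProductSpace ℝ E] [CompleteSpace E]
    (μ L R : ℝ) : Set ((E → ℝ) × E) :=
  {p | IsSmoothStronglyConvex μ L p.1 ∧ ∃ y ∈ solutionSet p.1, ‖y - p.2‖ ≤ R}

/-- The efficiency estimate of a method for the distance to the solution set: the worst case over
the problem instances in `I` (possibly infinite). -/
def distEfficiency {N : ℕ} (A : FirstOrderMethod E N) (I : Set ((E → ℝ) × E)) : ℝ≥0∞ :=
  ⨆ p ∈ I, Metric.infEDist (A.apply p.1 p.2) (solutionSet p.1)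

/-- The minimax error: the least efficiency estimate, for the distance to the solution set,
of deterministic first-order methods that perform at most `N` oracle calls. -/
def minimaxError (I : Set ((E → ℝ) × E)) (N : ℕ) : ℝ≥0∞ :=
  ⨅ A : FirstOrderMethod E N, distEfficiency A I

/-- `M` is the oracle complexity of `I` at accuracy `ε`, for the distance to the solution set:
the minimal number of oracle calls for which the minimax error is at most `ε`. -/
def IsOracleComplexity (I : Set ((E → ℝ) × E)) (ε : ℝ) (M : ℕ) : Prop :=
  IsLeast {n : ℕ | minimaxError I n ≤ ENNReal.ofReal ε} M

/-- The sequence `λ_i`, for the inverse condition number `q = μ / L`. -/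
def lambdaSeq (q : ℝ) : ℕ → ℝ
  | 0 => √q
  | i + 1 => (1 - √(q - (1 - q) * lambdaSeq q i ^ 2)) / (1 + lambdaSeq q i ^ 2) * lambdaSeq q i

/-- The scalar sequence `A_k` of the Information-Theoretic Exact Method. -/
def itemA (q : ℝ) : ℕ → ℝ
  | 0 => 0
  | k + 1 => ((1 + q) * itemA q k + 2 * (1 + √((1 + itemA q k) * (1 + q * itemA q k)))) /
      (1 - q) ^ 2

/-- The coefficient `β_k` of the Information-Theoretic Exact Method. -/
def itemBeta (q : ℝ) (k : ℕ) : ℝ := itemA q k / ((1 - q) * itemA q (k + 1))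

/-- The coefficient `δ_k` of the Information-Theoretic Exact Method. -/
def itemDelta (q : ℝ) (k : ℕ) : ℝ :=
  ((1 - q) ^ 2 * itemA q (k + 1) - (1 + q) * itemA q k) / (2 * (1 + q + q * itemA q k))

/-- `n` further iterations of the Information-Theoretic Exact Method from the iterates
`x = x_k`, `z = z_k`:
`y_k = (1 - β_k) z_k + β_k x_k`, `x_{k+1} = y_k - (1/L) ∇f(y_k)`,
`z_{k+1} = (1 - q δ_k) z_k + q δ_k y_k - (δ_k/L) ∇f(y_k)`, the output being the last `z`. -/
def itemProc (μ L : ℝ) : (n k : ℕ) → (x z : E) → FirstOrderProc E n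
  | 0, _, _, z => .output z
  | n + 1, k, x, z =>
    let q := μ / L
    let y := (1 - itemBeta q k) • z + itemBeta q k • x
    .query y fun _ g =>
      itemProc μ L n (k + 1) (y - (1 / L) • g)
        ((1 - q * itemDelta q k) • z + (q * itemDelta q k) • y - (itemDelta q k / L) • g)

/-- The Information-Theoretic Exact Method (ITEM) with `N` oracle calls. -/
def itemMethod (E : Type) [NormedAddCommGroup E] [InnerProductSpace ℝ E] (μ L : ℝ) (N : ℕ) :
    FirstOrderMethod E N := fun x₀ => itemProc μ L N 0 x₀ x₀

end

/-!
Write `q = μ / L` and `A_k` for the scalar sequence of ITEM. In closed form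
`λ_i = √(q / (1 + q A_i))` (`lambdaSeq_eq`), so the asserted minimax error is `R / √(1 + q A_N)`.
Everything about the sequences becomes rational in `r = √(1 + q A_k)` and `s = √(1 + A_k)`
(`exists_itemA_succ_eq`).

**Upper bound.** Let `x⋆` be a minimizer, `G` the gradient of `f - μ/2 ‖· - x⋆‖²`, and
`gap(u) = f(u) - f(x⋆) - μ/2 ‖u - x⋆‖² - ‖G(u)‖² / (2 (L - μ)) ≥ 0` the slack of the interpolation
inequality between `u` and `x⋆`. Adding the interpolation inequalities of the pairs
`(y_{k-1}, y_k)` and `(x⋆, y_k)` with weights `A_k` and `A_{k+1} - A_k` shows that the potential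
`(1 - q) / L * A_k * gap(y_{k-1}) + (1 + q A_k) ‖z_k - x⋆‖²` does not increase
(`item_potential_step`). It starts at `‖x₀ - x⋆‖² ≤ R²`.

**Lower bound.** For orthonormal `e_0, …, e_N` and coefficients `a_i ≤ b_i` with `a_N = b_N`, put
`p_j = ∑_{k < j} a_k e_k + b_j e_j`. The hard function is `μ/2 ‖·‖²` plus the smoothed maximum of
affine functions `⟪p_j, ·⟫ + c_j`, where `c_j` is a multiple of `⟪p_j, p_N⟫` chosen so that the
minimizer is `-p_N / μ`. When `b_{i+1} a_{i+1} = (b_i - a_i) (a_i - q b_i)`, the constants `c_j`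
decrease fast enough that a query orthogonal to `e_i, …, e_N` activates only the pieces `j ≤ i`
(`IsActive.of_orthogonal`), so that the answer reveals only `e_0, …, e_i`. An adversary can
therefore choose each `e_i` after the `i`-th query, which costs two dimensions per query, and the
sign of `e_N` after seeing the output (`exists_orthonormal_run_inner_nonneg`). The output is then at
distance at least `b_N / μ` from the minimizer, while the starting point `0` is at distance
`‖p_N‖ / μ`. The ratio `‖p_N‖² / b_N²` is smallest for `a_i / b_i = q δ_i`, where it equals
`1 + q A_N` (`exists_hardCoefficients`). The argument works in every dimension at least `2 N + 1`,
so in `ℝ^{2N+1}` it also covers fewer than `N` calls, which gives the exact oracle complexity.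
-/

/-! ### The scalar sequences -/

lemma itemA_nonneg {q : ℝ} (hq : 0 ≤ q) : ∀ k, 0 ≤ itemA q k
  | 0 => le_rfl
  | k + 1 => by
    have := itemA_nonneg hq k
    rw [itemA]
    positivity

/-- The numbers `r = √(1 + q A_k)` and `s = √(1 + A_k)` make the recursion of `A_k` rational:
`√A_{k+1} = (r + s) / (1 - q)`, `√(1 + q A_{k+1}) = (r + q s) / (1 - q)` and
`δ_k = (r + s) / (r + q s)`. -/
lemma exists_itemA_succ_eq {q : ℝ} (hq : 0 ≤ q) (hq1 : q < 1) (k : ℕ) :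
    ∃ r s, 0 < r ∧ 0 < s ∧ r ^ 2 = 1 + q * itemA q k ∧ s ^ 2 = 1 + itemA q k ∧
      itemA q (k + 1) = (r + s) ^ 2 / (1 - q) ^ 2 ∧
      1 + q * itemA q (k + 1) = (r + q * s) ^ 2 / (1 - q) ^ 2 ∧
      itemDelta q k = (r + s) / (r + q * s) := by
  have hA := itemA_nonneg hq k
  have h1 : 0 < 1 + q * itemA q k := by positivity
  have h2 : 0 < 1 + itemA q k := by positivity
  have hr : √(1 + q * itemA q k) ^ 2 = 1 + q * itemA q k := Real.sq_sqrt h1.le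
  have hs : √(1 + itemA q k) ^ 2 = 1 + itemA q k := Real.sq_sqrt h2.le
  have hrs : √((1 + itemA q k) * (1 + q * itemA q k)) =
      √(1 + itemA q k) * √(1 + q * itemA q k) := Real.sqrt_mul h2.le _
  have hr0 := Real.sqrt_pos.2 h1
  have hs0 := Real.sqrt_pos.2 h2
  have hq' : 1 - q ≠ 0 := by linarith
  have hA' : itemA q (k + 1) =
      (√(1 + q * itemA q k) + √(1 + itemA q k)) ^ 2 / (1 - q) ^ 2 := by
    rw [itemA, hrs]
    congr 1
    linear_combination -hr - hs
  have hr2 : (1 - q) ^ 2 ≠ 0 := pow_ne_zero 2 hq'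
  refine ⟨√(1 + q * itemA q k), √(1 + itemA q k), hr0, hs0, hr, hs, hA', ?_, ?_⟩
  · rw [hA', eq_div_iff hr2, add_mul, mul_div_assoc', div_mul_cancel₀ _ hr2]
    linear_combination (-1 + q) * hr - (q ^ 2 - q) * hs
  · have hD : 0 < 1 + q + q * itemA q k := by positivity
    rw [itemDelta, hA', mul_div_cancel₀ _ hr2, div_eq_div_iff (by positivity) (by positivity)]
    generalize √(1 + q * itemA q k) = r at *
    generalize √(1 + itemA q k) = s at *
    generalize itemA q k = A at *
    obtain rfl : A = s ^ 2 - 1 := by linarith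
    linear_combination (r + (2 + q) * s) * hr

lemma itemA_succ_pos {q : ℝ} (hq : 0 ≤ q) (hq1 : q < 1) (k : ℕ) : 0 < itemA q (k + 1) := by
  obtain ⟨r, s, hr, hs, -, -, h, -⟩ := exists_itemA_succ_eq hq hq1 k
  have : 0 < 1 - q := by linarith
  rw [h]
  positivity

/-- The `λ_i` in closed form: `λ_i = √(q / (1 + q A_i))`. -/
lemma lambdaSeq_eq {q : ℝ} (hq : 0 < q) (hq1 : q < 1) (i : ℕ) :
    lambdaSeq q i = √q / √(1 + q * itemA q i) := by
  induction i with
  | zero => simp [lambdaSeq, itemA]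
  | succ i ih =>
    obtain ⟨r, s, hr, hs, hr2, hs2, -, hA', -⟩ := exists_itemA_succ_eq hq.le hq1 i
    have hq' : 0 < 1 - q := by linarith
    have hlam : (√q / r) ^ 2 = q / r ^ 2 := by rw [div_pow, Real.sq_sqrt hq.le]
    have hrs : r ^ 2 = 1 - q + q * s ^ 2 := by linear_combination hr2 - q * hs2
    have hroot : √(q - (1 - q) * (q / r ^ 2)) = q * s / r := by
      rw [Real.sqrt_eq_iff_mul_self_eq_of_pos (by positivity)]
      field_simp
      linear_combination -hrs
    have hstep : (1 - q * s / r) / (1 + q / r ^ 2) / r = (1 - q) / (r + q * s) := by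
      field_simp
      linear_combination q * hrs
    rw [lambdaSeq, ih, hA', ← hr2, Real.sqrt_sq hr.le, hlam, hroot, ← div_pow,
      Real.sqrt_sq (by positivity)]
    calc _ = √q * ((1 - q * s / r) / (1 + q / r ^ 2) / r) := by ring
      _ = _ := by rw [hstep]; field_simp

lemma lambdaSeq_mul_div {q : ℝ} (hq : 0 < q) (hq1 : q < 1) (R : ℝ) (i : ℕ) :
    lambdaSeq q i * R / √q = R / √(1 + q * itemA q i) := by
  rw [lambdaSeq_eq hq hq1]
  have := Real.sqrt_pos.2 hq
  field_simp

lemma lambdaSeq_radicand_nonneg {q : ℝ} (hq : 0 < q) (hq1 : q < 1) (i : ℕ) :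
    0 ≤ q - (1 - q) * lambdaSeq q i ^ 2 := by
  have hA := itemA_nonneg hq.le i
  have hB : 0 < 1 + q * itemA q i := by positivity
  rw [lambdaSeq_eq hq hq1, div_pow, Real.sq_sqrt hq.le, Real.sq_sqrt hB.le]
  have : q - (1 - q) * (q / (1 + q * itemA q i)) =
      q ^ 2 * (1 + itemA q i) / (1 + q * itemA q i) := by
    field_simp
    ring
  rw [this]
  positivity

noncomputable section

open scoped RealInnerProductSpace

section Upper

variable {E : Type} [NormedAddCommGroup E] [InnerProductSpace ℝ E] [CompleteSpace E]

/-! ### Inequalities for smooth strongly convex functions -/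

lemma IsSmoothStronglyConvex.hasGradientAt {μ L : ℝ} {f : E → ℝ}
    (hf : IsSmoothStronglyConvex μ L f) (x : E) : HasGradientAt f (gradient f x) x :=
  ((hf.2.1.differentiable one_ne_zero) x).hasGradientAt

lemma HasGradientAt.hasDerivAt_add_smul {f : E → ℝ} {g x d : E} {t : ℝ}
    (h : HasGradientAt f g (x + t • d)) : HasDerivAt (fun t : ℝ => f (x + t • d)) ⟪g, d⟫ t := by
  have h1 : HasDerivAt (fun t : ℝ => x + t • d) d t := by
    simpa using ((hasDerivAt_id t).smul_const d).const_add x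
  have h2 := h.hasFDerivAt.comp_hasDerivAt t h1
  rwa [InnerProductSpace.toDual_apply_apply] at h2

/-- The convex function `f - μ/2 ‖·‖²` lies above its tangent at `x`, along the line through `x` and
`y`. -/
lemma IsSmoothStronglyConvex.quadratic_lower_bound {μ L : ℝ} {f : E → ℝ}
    (hf : IsSmoothStronglyConvex μ L f) (x y : E) :
    f x + ⟪gradient f x, y - x⟫ + μ / 2 * ‖y - x‖ ^ 2 ≤ f y := by
  have hc := (strongConvexOn_iff_convex.1 hf.1).comp_affineMap (AffineMap.lineMap x y)
  rw [Set.preimage_univ] at hc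
  have hl : ∀ t : ℝ, AffineMap.lineMap x y t = x + t • (y - x) := fun t => by
    rw [AffineMap.lineMap_apply, vsub_eq_sub, vadd_eq_add, add_comm]
  have hfun : (fun t : ℝ => f (x + t • (y - x)) -
      μ / 2 * (‖x‖ ^ 2 + 2 * t * ⟪x, y - x⟫ + t ^ 2 * ‖y - x‖ ^ 2)) =
      (fun x => f x - μ / 2 * ‖x‖ ^ 2) ∘ AffineMap.lineMap x y := by
    ext t
    simp only [Function.comp_apply, hl, norm_add_sq_real, norm_smul, real_inner_smul_right,
      mul_pow, Real.norm_eq_abs, sq_abs]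
    ring
  rw [← hfun] at hc
  have hd : HasDerivAt (fun t : ℝ => f (x + t • (y - x)) -
      μ / 2 * (‖x‖ ^ 2 + 2 * t * ⟪x, y - x⟫ + t ^ 2 * ‖y - x‖ ^ 2))
      (⟪gradient f x, y - x⟫ - μ * ⟪x, y - x⟫) 0 := by
    have h1 : HasDerivAt (fun t : ℝ => f (x + t • (y - x))) ⟪gradient f x, y - x⟫ 0 :=
      HasGradientAt.hasDerivAt_add_smul (by simpa using hf.hasGradientAt x)
    have h2 : HasDerivAt (fun t : ℝ => 2 * t * ⟪x, y - x⟫) (2 * ⟪x, y - x⟫) 0 := by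
      simpa using ((hasDerivAt_id (0 : ℝ)).const_mul 2).mul_const ⟪x, y - x⟫
    have h3 : HasDerivAt (fun t : ℝ => t ^ 2 * ‖y - x‖ ^ 2) 0 0 := by
      simpa using (hasDerivAt_pow 2 (0 : ℝ)).mul_const (‖y - x‖ ^ 2)
    exact (h1.sub (((h2.const_add (‖x‖ ^ 2)).add h3).const_mul (μ / 2))).congr_deriv (by ring)
  have hs := hc.le_slope_of_hasDerivAt (Set.mem_univ 0) (Set.mem_univ 1) zero_lt_one hd
  simp only [slope_def_field, one_smul, zero_smul, add_zero, add_sub_cancel, sub_zero, div_one]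
    at hs
  linarith

lemma IsSmoothStronglyConvex.quadratic_upper_bound {μ L : ℝ} {f : E → ℝ}
    (hf : IsSmoothStronglyConvex μ L f) (x y : E) :
    f y ≤ f x + ⟪gradient f x, y - x⟫ + L / 2 * ‖y - x‖ ^ 2 := by
  set d := y - x with hd
  have hder : ∀ t : ℝ, HasDerivAt
      (fun t : ℝ => f (x + t • d) - t * ⟪gradient f x, d⟫ - L / 2 * ‖d‖ ^ 2 * t ^ 2)
      (⟪gradient f (x + t • d), d⟫ - ⟪gradient f x, d⟫ - L * ‖d‖ ^ 2 * t) t := fun t => by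
    have h1 : HasDerivAt (fun t : ℝ => f (x + t • d)) ⟪gradient f (x + t • d), d⟫ t :=
      HasGradientAt.hasDerivAt_add_smul (hf.hasGradientAt _)
    exact ((h1.sub ((hasDerivAt_id t).mul_const ⟪gradient f x, d⟫)).sub
      ((hasDerivAt_pow 2 t).const_mul (L / 2 * ‖d‖ ^ 2))).congr_deriv (by push_cast; ring)
  have hanti := antitoneOn_of_hasDerivWithinAt_nonpos (convex_Icc (0 : ℝ) 1)
    (fun t _ => (hder t).continuousAt.continuousWithinAt)
    (fun t _ => (hder t).hasDerivWithinAt) (fun t ht => by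
      rw [interior_Icc] at ht
      have h1 : ⟪gradient f (x + t • d) - gradient f x, d⟫ ≤ L * ‖t • d‖ * ‖d‖ :=
        (real_inner_le_norm _ _).trans <| mul_le_mul_of_nonneg_right
          (by simpa using hf.2.2 (x + t • d) x) (norm_nonneg _)
      rw [inner_sub_left, norm_smul, Real.norm_of_nonneg ht.1.le] at h1
      nlinarith)
  have h := hanti (Set.left_mem_Icc.2 zero_le_one) (Set.right_mem_Icc.2 zero_le_one) zero_le_one
  simp only [zero_smul, one_smul, add_zero, hd, add_sub_cancel] at h
  rw [← hd] at h
  linarith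

/-- The interpolation inequality of smooth strongly convex functions. It compares the two quadratic
bounds at the minimizer `x - w / (L - μ)` of their difference,
`w = ∇f(x) - ∇f(y) - μ (x - y)`. -/
lemma IsSmoothStronglyConvex.interpolation {μ L : ℝ} (hμL : μ < L) {f : E → ℝ}
    (hf : IsSmoothStronglyConvex μ L f) (x y : E) :
    f y + ⟪gradient f y, x - y⟫ + μ / 2 * ‖x - y‖ ^ 2 +
      1 / (2 * (L - μ)) * ‖gradient f x - gradient f y - μ • (x - y)‖ ^ 2 ≤ f x := by
  obtain ⟨w, hw⟩ : ∃ w, w = gradient f x - gradient f y - μ • (x - y) := ⟨_, rfl⟩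
  obtain ⟨d, hd⟩ : ∃ d, d = x - y := ⟨_, rfl⟩
  have hl : 0 < L - μ := by linarith
  have h1 := hf.quadratic_upper_bound x (x - (1 / (L - μ)) • w)
  have h2 := hf.quadratic_lower_bound y (x - (1 / (L - μ)) • w)
  have hgx : gradient f x = gradient f y + μ • d + w := by rw [hw, hd]; abel
  have e1 : x - (1 / (L - μ)) • w - x = -((1 / (L - μ)) • w) := by abel
  have e2 : x - (1 / (L - μ)) • w - y = d - (1 / (L - μ)) • w := by rw [hd]; abel
  rw [← hw, ← hd]
  rw [e1, hgx] at h1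
  rw [e2] at h2
  have h := h2.trans h1
  simp only [inner_add_left, inner_sub_right, inner_neg_right, real_inner_smul_right,
    real_inner_smul_left, norm_neg, norm_sub_sq_real, norm_smul, mul_pow, Real.norm_eq_abs, sq_abs,
    real_inner_self_eq_norm_sq] at h
  have e3 : (L / 2) * ((1 / (L - μ)) ^ 2 * ‖w‖ ^ 2) =
      1 / (2 * (L - μ)) * ‖w‖ ^ 2 + μ / 2 * ((1 / (L - μ)) ^ 2 * ‖w‖ ^ 2) := by
    field_simp
    ring
  have e4 : 1 / (2 * (L - μ)) * ‖w‖ ^ 2 = 1 / (L - μ) * ‖w‖ ^ 2 / 2 := by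
    field_simp
  linarith

lemma gradient_eq_zero_of_mem_solutionSet {f : E → ℝ} {x : E} (hx : x ∈ solutionSet f) :
    gradient f x = 0 := by
  have h : IsLocalMin f x := IsMinOn.isLocalMin hx Filter.univ_mem
  rw [gradient, h.fderiv_eq_zero, map_zero]

/-! ### The upper bound: convergence of ITEM -/

/-- The gradient of `f - μ/2 ‖· - xs‖²`, where `xs` is a minimizer of `f`. -/
def shiftedGradient (μ : ℝ) (f : E → ℝ) (xs u : E) : E := gradient f u - μ • (u - xs)

/-- The slack of the interpolation inequality of `f` between a point `u` and a minimizer `xs`. -/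
def interpolationGap (μ L : ℝ) (f : E → ℝ) (xs u : E) : ℝ :=
  f u - f xs - μ / 2 * ‖u - xs‖ ^ 2 - 1 / (2 * (L - μ)) * ‖shiftedGradient μ f xs u‖ ^ 2

lemma interpolationGap_nonneg {μ L : ℝ} (hμL : μ < L) {f : E → ℝ}
    (hf : IsSmoothStronglyConvex μ L f) {xs : E} (hxs : xs ∈ solutionSet f) (u : E) :
    0 ≤ interpolationGap μ L f xs u := by
  have h := hf.interpolation hμL u xs
  rw [gradient_eq_zero_of_mem_solutionSet hxs, inner_zero_left, sub_zero] at h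
  rw [interpolationGap, shiftedGradient]
  linarith

/-- The weighted sum of the interpolation inequalities between `u` and `y`, with weight `A`, and
between `xs` and `y`, with weight `A' - A`. -/
lemma interpolationGap_weighted {μ L : ℝ} (hμL : μ < L) {f : E → ℝ}
    (hf : IsSmoothStronglyConvex μ L f) {xs : E} (hxs : xs ∈ solutionSet f) (u y : E)
    {A A' : ℝ} (hA : 0 ≤ A) (hAA' : A ≤ A') :
    A' * interpolationGap μ L f xs y +
      ⟪shiftedGradient μ f xs y,
        A • (u - xs - (1 / (L - μ)) • shiftedGradient μ f xs u) - A' • (y - xs)⟫ +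
      A' * (1 / (L - μ) * ‖shiftedGradient μ f xs y‖ ^ 2) ≤
      A * interpolationGap μ L f xs u := by
  have h1 := hf.interpolation hμL u y
  have h2 := hf.interpolation hμL xs y
  rw [gradient_eq_zero_of_mem_solutionSet hxs] at h2
  obtain ⟨U, hU⟩ : ∃ U, U = u - xs := ⟨_, rfl⟩
  obtain ⟨Y, hY⟩ : ∃ Y, Y = y - xs := ⟨_, rfl⟩
  obtain ⟨G, hG⟩ : ∃ G, G = shiftedGradient μ f xs u := ⟨_, rfl⟩
  obtain ⟨H, hH⟩ : ∃ H, H = shiftedGradient μ f xs y := ⟨_, rfl⟩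
  have e1 : gradient f u = G + μ • U := by rw [hG, hU, shiftedGradient]; abel
  have e2 : gradient f y = H + μ • Y := by rw [hH, hY, shiftedGradient]; abel
  have e3 : u - y = U - Y := by rw [hU, hY]; abel
  have e4 : xs - y = -Y := by rw [hY]; abel
  have e5 : G + μ • U - (H + μ • Y) - μ • (U - Y) = G - H := by rw [smul_sub]; abel
  have e6 : 0 - (H + μ • Y) - μ • -Y = -H := by rw [smul_neg]; abel
  rw [e1, e2, e3, e5] at h1
  rw [e2, e4, e6] at h2
  rw [interpolationGap, interpolationGap, ← hG, ← hH, ← hU, ← hY]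
  simp only [inner_add_left, inner_sub_right, inner_neg_right, real_inner_smul_right,
    real_inner_smul_left, norm_neg, norm_sub_sq_real, real_inner_self_eq_norm_sq,
    real_inner_comm H G, real_inner_comm Y U] at h1 h2 ⊢
  have h1' := mul_le_mul_of_nonneg_left h1 hA
  have h2' := mul_le_mul_of_nonneg_left h2 (sub_nonneg.2 hAA')
  have hl : 1 / (L - μ) = 2 * (1 / (2 * (L - μ))) := by
    have : L - μ ≠ 0 := by linarith
    field_simp
  rw [hl]
  linarith

/-- The relations that make the sum of the interpolation inequalities match, coefficient by
coefficient, the change of `(1 + q A_k) ‖z_k - xs‖²` in one iteration. -/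
lemma item_coefficients {q : ℝ} (hq : 0 ≤ q) (hq1 : q < 1) (k : ℕ) :
    (1 + q * itemA q (k + 1)) * (1 - q * itemDelta q k) ^ 2 = 1 + q * itemA q k ∧
    2 * ((1 + q * itemA q (k + 1)) * (1 - q * itemDelta q k) * itemDelta q k) =
      (1 - q) * itemA q (k + 1) - itemA q k ∧
    (1 + q * itemA q (k + 1)) * itemDelta q k ^ 2 = itemA q (k + 1) ∧
    itemA q k ≤ itemA q (k + 1) := by
  obtain ⟨r, s, hr, hs, hr2, hs2, hA, hA', hδ⟩ := exists_itemA_succ_eq hq hq1 k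
  have hq' : 0 < 1 - q := by linarith
  have hD : 0 < r + q * s := by positivity
  have hA0 := itemA_nonneg hq k
  have h1 : 1 - q * itemDelta q k = (1 - q) * r / (r + q * s) := by
    rw [hδ]; field_simp; ring
  refine ⟨?_, ?_, ?_, ?_⟩
  · rw [h1, hA', ← hr2]; field_simp
  · rw [h1, hA', hδ, hA]
    field_simp
    linear_combination hr2 - hs2
  · rw [hA', hδ, hA]; field_simp
  · rw [hA, le_div_iff₀ (by positivity)]
    nlinarith [mul_pos hr hs, mul_nonneg hA0 hq]

/-- One iteration of ITEM from `x`, `z` to `z'` does not increase the potential. The point `u` is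
the previous query point `y_{k-1}`; `hx` says that `x` is a gradient step from `u`, and says nothing
when `k = 0`, since `A_0 = 0`. -/
lemma item_potential_step {μ L : ℝ} (hμ : 0 < μ) (hμL : μ < L) {f : E → ℝ}
    (hf : IsSmoothStronglyConvex μ L f) {xs : E} (hxs : xs ∈ solutionSet f) (k : ℕ)
    {x z u y z' : E}
    (hx : itemA (μ / L) k • (x - xs) = ((1 - μ / L) * itemA (μ / L) k) •
      (u - xs - (1 / (L - μ)) • shiftedGradient μ f xs u))
    (hy : y = (1 - itemBeta (μ / L) k) • z + itemBeta (μ / L) k • x)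
    (hz' : z' = (1 - μ / L * itemDelta (μ / L) k) • z + (μ / L * itemDelta (μ / L) k) • y -
      (itemDelta (μ / L) k / L) • gradient f y) :
    (1 - μ / L) / L * itemA (μ / L) (k + 1) * interpolationGap μ L f xs y +
        (1 + μ / L * itemA (μ / L) (k + 1)) * ‖z' - xs‖ ^ 2 ≤
      (1 - μ / L) / L * itemA (μ / L) k * interpolationGap μ L f xs u +
        (1 + μ / L * itemA (μ / L) k) * ‖z - xs‖ ^ 2 := by
  have hL : 0 < L := hμ.trans hμL
  obtain ⟨q, hq⟩ : ∃ q, q = μ / L := ⟨_, rfl⟩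
  have hq0 : 0 < q := hq ▸ div_pos hμ hL
  have hq1 : q < 1 := hq ▸ (div_lt_one hL).2 hμL
  have hμq : μ = q * L := by rw [hq]; field_simp
  rw [← hq] at hx hy hz' ⊢
  obtain ⟨c1, c2, c3, c4⟩ := item_coefficients hq0.le hq1 k
  have hA0 := itemA_nonneg hq0.le k
  have hA'0 := itemA_succ_pos hq0.le hq1 k
  have hw := interpolationGap_weighted hμL hf hxs u y hA0 c4
  obtain ⟨H, hH⟩ : ∃ H, H = shiftedGradient μ f xs y := ⟨_, rfl⟩
  have hgy : gradient f y = H + μ • (y - xs) := by rw [hH, shiftedGradient]; abel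
  rw [itemBeta] at hy
  rw [← hH] at hw
  generalize itemDelta q k = δ at *
  generalize itemA q (k + 1) = A' at *
  generalize itemA q k = A at *
  have hq' : 1 - q ≠ 0 := by linarith
  have ez : z' - xs = (1 - q * δ) • (z - xs) - (δ / L) • H := by
    rw [hz', hgy, hμq]
    match_scalars <;> field_simp <;> ring
  have ey : A' • (y - xs) = (A' - A / (1 - q)) • (z - xs) + (1 / (1 - q)) • (A • (x - xs)) := by
    rw [hy]
    match_scalars <;> field_simp
    ring
  have ew : A • (u - xs - (1 / (L - μ)) • shiftedGradient μ f xs u) - A' • (y - xs) =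
      -((A' - A / (1 - q)) • (z - xs)) := by
    rw [ey, hx, smul_smul]
    have : 1 / (1 - q) * ((1 - q) * A) = A := by field_simp
    rw [this]
    abel
  rw [ew, inner_neg_right, real_inner_smul_right] at hw
  rw [ez]
  generalize z - xs = Z at hw ⊢
  simp only [norm_sub_sq_real, norm_smul, mul_pow, Real.norm_eq_abs, sq_abs,
    real_inner_smul_left, real_inner_smul_right, real_inner_comm H (Z)]
  have hmul := mul_le_mul_of_nonneg_left hw (show 0 ≤ (1 - q) / L by
    have : 0 < 1 - q := by linarith
    positivity)
  have hl : 1 / (L - μ) = 1 / ((1 - q) * L) := by rw [hμq]; ring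
  rw [hl] at hmul
  have t1 : (1 - q) / L * (A' * (1 / ((1 - q) * L) * ‖H‖ ^ 2)) =
      (1 + q * A') * ((δ / L) ^ 2 * ‖H‖ ^ 2) := by
    have : (1 - q) / L * (A' * (1 / ((1 - q) * L) * ‖H‖ ^ 2)) = A' * (‖H‖ ^ 2 / L ^ 2) := by
      field_simp
    rw [this]
    linear_combination (-(‖H‖ ^ 2 / L ^ 2)) * c3
  have t2 : (1 - q) / L * ((A' - A / (1 - q)) * ⟪H, Z⟫) =
      (1 + q * A') * (2 * ((1 - q * δ) * (δ / L * ⟪H, Z⟫))) := by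
    have : (1 - q) / L * (A' - A / (1 - q)) = ((1 - q) * A' - A) / L := by field_simp
    rw [← mul_assoc, this, ← c2]; field_simp
  have t3 : (1 + q * A') * ((1 - q * δ) ^ 2 * ‖Z‖ ^ 2) = (1 + q * A) * ‖Z‖ ^ 2 := by
    rw [← c1]; ring
  linarith

/-- The bound for the output of `n` iterations of ITEM started at step `k`, with `u` as in
`item_potential_step` and `C` a bound for the potential at step `k`. -/
lemma itemProc_run {μ L : ℝ} (hμ : 0 < μ) (hμL : μ < L) {f : E → ℝ}
    (hf : IsSmoothStronglyConvex μ L f) {xs : E} (hxs : xs ∈ solutionSet f) {C : ℝ}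
    (n : ℕ) : ∀ (k : ℕ) (x z u : E),
    itemA (μ / L) k • (x - xs) = ((1 - μ / L) * itemA (μ / L) k) •
      (u - xs - (1 / (L - μ)) • shiftedGradient μ f xs u) →
    (1 - μ / L) / L * itemA (μ / L) k * interpolationGap μ L f xs u +
        (1 + μ / L * itemA (μ / L) k) * ‖z - xs‖ ^ 2 ≤ C →
    (1 + μ / L * itemA (μ / L) (k + n)) *
      ‖(itemProc μ L n k x z).run (firstOrderOracle f) - xs‖ ^ 2 ≤ C := by
  have hL : 0 < L := hμ.trans hμL
  have hq1 : 0 < 1 - μ / L := sub_pos.2 ((div_lt_one hL).2 hμL)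
  induction n with
  | zero =>
    intro k x z u hx h
    have := itemA_nonneg (div_pos hμ hL).le k
    have := interpolationGap_nonneg hμL hf hxs u
    have : 0 ≤ (1 - μ / L) / L * itemA (μ / L) k * interpolationGap μ L f xs u := by positivity
    rw [itemProc, FirstOrderProc.run, add_zero]
    linarith
  | succ n ih =>
    intro k x z u hx h
    rw [itemProc, FirstOrderProc.run, show k + (n + 1) = k + 1 + n by ring]
    refine ih (k + 1) _ _ ((1 - itemBeta (μ / L) k) • z + itemBeta (μ / L) k • x) ?_
      ((item_potential_step hμ hμL hf hxs k hx rfl rfl).trans h)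
    simp only [firstOrderOracle]
    rw [mul_comm, mul_smul, shiftedGradient]
    congr 1
    have : L - μ ≠ 0 := by linarith
    generalize (1 - itemBeta (μ / L) k) • z + itemBeta (μ / L) k • x = y
    match_scalars <;> field_simp <;> ring

lemma distEfficiency_itemMethod_le {μ L R : ℝ} (hμ : 0 < μ) (hμL : μ < L) (N : ℕ) :
    distEfficiency (itemMethod E μ L N) (problemClass E μ L R) ≤
      ENNReal.ofReal (R / √(1 + μ / L * itemA (μ / L) N)) := by
  have hL : 0 < L := hμ.trans hμL
  have hA := itemA_nonneg (div_pos hμ hL).le N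
  have hB : 0 < 1 + μ / L * itemA (μ / L) N := by positivity
  refine iSup₂_le ?_
  rintro ⟨f, x₀⟩ ⟨hf, xs, hxs, hR⟩
  refine (Metric.infEDist_le_edist_of_mem hxs).trans ?_
  rw [edist_dist, dist_eq_norm]
  refine ENNReal.ofReal_le_ofReal ?_
  have h := itemProc_run hμ hμL hf hxs (C := R ^ 2) N 0 x₀ x₀ x₀ (by simp [itemA]) (by
    simp only [itemA, mul_zero, zero_mul, add_zero, zero_add, one_mul]
    rw [norm_sub_rev]
    exact pow_le_pow_left₀ (norm_nonneg _) hR 2)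
  rw [zero_add] at h
  rw [le_div_iff₀ (Real.sqrt_pos.2 hB)]
  refine abs_le_of_sq_le_sq' ?_ ((norm_nonneg _).trans hR) |>.2
  rw [mul_pow, Real.sq_sqrt hB.le, mul_comm]
  exact h

end Upper

section Lower

variable {E : Type} [NormedAddCommGroup E] [InnerProductSpace ℝ E]

/-! ### Smoothed maxima of affine functions -/

/-- A convex function `h` with a Lipschitz selection `v` of subgradients is differentiable with
gradient `v`. The statement is for `μ/2 ‖·‖² + h`. -/
lemma hasGradientAt_of_subgradient [CompleteSpace E] {μ l : ℝ} (hμ : 0 ≤ μ) {h : E → ℝ} {v : E → E}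
    (hsub : ∀ x y, h x + ⟪v x, y - x⟫ ≤ h y) (hlip : ∀ x y, ‖v x - v y‖ ≤ l * ‖x - y‖) (x : E) :
    HasGradientAt (fun x => μ / 2 * ‖x‖ ^ 2 + h x) (μ • x + v x) x := by
  rw [hasGradientAt_iff_isLittleO]
  refine Asymptotics.IsBigO.trans_isLittleO ?_
    (Asymptotics.isLittleO_pow_sub_sub x (m := 2) one_lt_two)
  refine Asymptotics.IsBigO.of_bound (μ / 2 + l) (Filter.Eventually.of_forall fun y => ?_)
  have h1 := hsub x y
  have h2 := hsub y x
  have h3 : ⟪v y - v x, y - x⟫ ≤ l * ‖y - x‖ * ‖y - x‖ :=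
    (real_inner_le_norm _ _).trans (mul_le_mul_of_nonneg_right (hlip y x) (norm_nonneg _))
  have h4 : ‖y‖ ^ 2 = ‖x‖ ^ 2 + 2 * ⟪x, y - x⟫ + ‖y - x‖ ^ 2 := by
    rw [← norm_add_sq_real, add_sub_cancel]
  have h5 : ⟪v y, x - y⟫ = -⟪v y, y - x⟫ := by rw [← inner_neg_right, neg_sub]
  rw [inner_sub_left] at h3
  have h6 : μ / 2 * ‖y‖ ^ 2 + h y - (μ / 2 * ‖x‖ ^ 2 + h x) - ⟪μ • x + v x, y - x⟫ =
      μ / 2 * ‖y - x‖ ^ 2 + (h y - h x - ⟪v x, y - x⟫) := by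
    rw [h4, inner_add_left, real_inner_smul_left]
    ring
  have h7 : 0 ≤ μ / 2 * ‖y - x‖ ^ 2 := by positivity
  rw [h6, Real.norm_of_nonneg (by linarith), Real.norm_of_nonneg (by positivity)]
  linarith

lemma isSmoothStronglyConvex_of_subgradient [CompleteSpace E] {μ l : ℝ} (hμ : 0 ≤ μ)
    {h : E → ℝ} {v : E → E} (hsub : ∀ x y, h x + ⟪v x, y - x⟫ ≤ h y)
    (hlip : ∀ x y, ‖v x - v y‖ ≤ l * ‖x - y‖) :
    IsSmoothStronglyConvex μ (μ + l) (fun x => μ / 2 * ‖x‖ ^ 2 + h x) := by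
  have hgrad := hasGradientAt_of_subgradient hμ hsub hlip
  have hbound : ∀ x y : E, ‖μ • x + v x - (μ • y + v y)‖ ≤ (μ + l) * ‖x - y‖ := fun x y => by
    have : μ • x + v x - (μ • y + v y) = μ • (x - y) + (v x - v y) := by rw [smul_sub]; abel
    rw [this, add_mul]
    refine (norm_add_le _ _).trans (add_le_add ?_ (hlip x y))
    rw [norm_smul, Real.norm_of_nonneg hμ]
  refine ⟨?_, ?_, fun x y => ?_⟩
  · rw [strongConvexOn_iff_convex]
    simp only [add_sub_cancel_left]
    refine ⟨convex_univ, fun x _ y _ s t hs ht hst => ?_⟩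
    have h1 := mul_le_mul_of_nonneg_left (hsub (s • x + t • y) x) hs
    have h2 := mul_le_mul_of_nonneg_left (hsub (s • x + t • y) y) ht
    have h3 : s * ⟪v (s • x + t • y), x - (s • x + t • y)⟫ +
        t * ⟪v (s • x + t • y), y - (s • x + t • y)⟫ = 0 := by
      rw [← real_inner_smul_right, ← real_inner_smul_right, ← inner_add_right]
      convert inner_zero_right _
      obtain rfl : t = 1 - s := by linarith
      module
    simp only [smul_eq_mul]
    have h4 : h (s • x + t • y) = s * h (s • x + t • y) + t * h (s • x + t • y) := by
      rw [← add_mul, hst, one_mul]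
    linarith
  · rw [contDiff_one_iff_fderiv]
    refine ⟨fun x => (hgrad x).differentiableAt, ?_⟩
    have hf : fderiv ℝ (fun x => μ / 2 * ‖x‖ ^ 2 + h x) =
        fun x => InnerProductSpace.toDual ℝ E (μ • x + v x) :=
      funext fun x => (hgrad x).hasFDerivAt.fderiv
    rw [hf]
    refine (InnerProductSpace.toDual ℝ E).continuous.comp ?_
    refine (LipschitzWith.of_dist_le_mul (K := (μ + l).toNNReal) fun x y => ?_).continuous
    rw [dist_eq_norm, dist_eq_norm]
    exact (hbound x y).trans
      (mul_le_mul_of_nonneg_right (Real.le_coe_toNNReal _) (norm_nonneg _))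
  · rw [(hgrad x).gradient, (hgrad y).gradient]
    exact hbound x y

/-- A pair `(v, c)` stands for the affine function `⟪v, ·⟫ + c`. The pair `p` is active at `x` for
the set `K` if it maximizes `⟪v, x⟫ + c - ‖v‖² / (2l)` over `(v, c) ∈ K`. For convex `K` this is
expressed by the first-order optimality condition. -/
def IsActive (l : ℝ) (K : Set (E × ℝ)) (x : E) (p : E × ℝ) : Prop :=
  p ∈ K ∧ ∀ w ∈ K, ⟪w.1 - p.1, x - (1 / l) • p.1⟫ + w.2 - p.2 ≤ 0

lemma IsActive.monotone {l : ℝ} {K : Set (E × ℝ)} {x y : E} {p p' : E × ℝ}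
    (hp : IsActive l K x p) (hp' : IsActive l K y p') :
    1 / l * ‖p.1 - p'.1‖ ^ 2 ≤ ⟪p.1 - p'.1, x - y⟫ := by
  have h1 := hp.2 _ hp'.1
  have h2 := hp'.2 _ hp.1
  rw [← neg_sub p.1 p'.1, inner_neg_left] at h1
  have h3 : ⟪p.1 - p'.1, x - (1 / l) • p.1⟫ - ⟪p.1 - p'.1, y - (1 / l) • p'.1⟫ =
      ⟪p.1 - p'.1, x - y⟫ - 1 / l * ‖p.1 - p'.1‖ ^ 2 := by
    rw [← inner_sub_right, ← real_inner_self_eq_norm_sq, ← real_inner_smul_right,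
      ← inner_sub_right]
    congr 1
    rw [smul_sub]
    abel
  linarith

lemma IsActive.norm_sub_le {l : ℝ} (hl : 0 < l) {K : Set (E × ℝ)} {x y : E} {p p' : E × ℝ}
    (hp : IsActive l K x p) (hp' : IsActive l K y p') : ‖p.1 - p'.1‖ ≤ l * ‖x - y‖ := by
  have h := (hp.monotone hp').trans (real_inner_le_norm _ _)
  rcases (norm_nonneg (p.1 - p'.1)).eq_or_lt with h0 | h0
  · rw [← h0]; positivity
  · rw [one_div, inv_mul_le_iff₀ hl] at h
    nlinarith

lemma IsActive.unique {l : ℝ} (hl : 0 < l) {K : Set (E × ℝ)} {x : E} {p p' : E × ℝ}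
    (hp : IsActive l K x p) (hp' : IsActive l K x p') : p = p' := by
  have h1 : p.1 = p'.1 := by
    have h := hp.norm_sub_le hl hp'
    rw [sub_self, norm_zero, mul_zero] at h
    exact sub_eq_zero.1 (norm_le_zero_iff.1 h)
  have h2 := hp.2 _ hp'.1
  have h3 := hp'.2 _ hp.1
  rw [h1, sub_self, inner_zero_left] at h2 h3
  exact Prod.ext h1 (by linarith)

lemma exists_isActive {l : ℝ} (hl : 0 < l) {K : Set (E × ℝ)} (hc : IsCompact K)
    (hK : Convex ℝ K) (hne : K.Nonempty) (x : E) : ∃ p, IsActive l K x p := by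
  obtain ⟨p, hp, hmax⟩ := hc.exists_isMaxOn hne
    (f := fun p : E × ℝ => ⟪p.1, x⟫ + p.2 - 1 / (2 * l) * ‖p.1‖ ^ 2) (by fun_prop)
  refine ⟨p, hp, fun w hw => ?_⟩
  by_contra! hD
  set D := ⟪w.1 - p.1, x - (1 / l) • p.1⟫ + w.2 - p.2 with hDdef
  -- Moving from `p` towards `w` by the fraction `t` changes the objective by `t * D - t ^ 2 * M`.
  set M := 1 / (2 * l) * ‖w.1 - p.1‖ ^ 2 with hM
  have hM0 : 0 ≤ M := by positivity
  have hDM : 0 < D + M := by linarith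
  set t := D / (D + M) with ht
  have ht0 : 0 < t := div_pos hD hDM
  have ht1 : t ≤ 1 := (div_le_one hDM).2 (by linarith)
  have hmem : p + t • (w - p) ∈ K := hK.add_smul_sub_mem hp hw ⟨ht0.le, ht1⟩
  have h := hmax hmem
  simp only [Set.mem_ofPred_eq, Prod.fst_add, Prod.smul_fst, Prod.fst_sub, Prod.snd_add,
    Prod.smul_snd, Prod.snd_sub, smul_eq_mul, inner_add_left, real_inner_smul_left,
    norm_add_sq_real, norm_smul, mul_pow, Real.norm_eq_abs, sq_abs, real_inner_smul_right] at h
  have h1 : D = ⟪w.1 - p.1, x⟫ - 2 * (1 / (2 * l)) * ⟪p.1, w.1 - p.1⟫ + w.2 - p.2 := by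
    rw [hDdef, inner_sub_right, real_inner_smul_right, real_inner_comm p.1]
    field_simp
  have h2 : t * D ≤ t * (t * M) := by rw [h1, hM]; linarith
  have h3 : D ≤ t * M := le_of_mul_le_mul_left h2 ht0
  rw [ht, div_mul_eq_mul_div, le_div_iff₀ hDM] at h3
  nlinarith

open Classical in
/-- The active pair of `K` at `x`; it is unique by `IsActive.unique`, and exists for nonempty
compact convex `K`. -/
def activePair (l : ℝ) (K : Set (E × ℝ)) (x : E) : E × ℝ :=
  if h : ∃ p, IsActive l K x p then h.choose else 0

lemma IsActive.activePair_eq {l : ℝ} (hl : 0 < l) {K : Set (E × ℝ)} {x : E} {p : E × ℝ}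
    (hp : IsActive l K x p) : activePair l K x = p := by
  have h : ∃ p, IsActive l K x p := ⟨p, hp⟩
  rw [activePair, dif_pos h]
  exact h.choose_spec.unique hl hp

/-- The smoothed maximum `max {⟪v, x⟫ + c - ‖v‖² / (2l) | (v, c) ∈ K}` of affine functions. -/
def smoothMax (l : ℝ) (K : Set (E × ℝ)) (x : E) : ℝ :=
  ⟪(activePair l K x).1, x⟫ + (activePair l K x).2 - 1 / (2 * l) * ‖(activePair l K x).1‖ ^ 2

lemma IsActive.le_smoothMax {l : ℝ} (hl : 0 < l) {K : Set (E × ℝ)} {x : E} {p w : E × ℝ}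
    (hp : IsActive l K x p) (hw : w ∈ K) :
    ⟪w.1, x⟫ + w.2 - 1 / (2 * l) * ‖w.1‖ ^ 2 ≤ smoothMax l K x := by
  rw [smoothMax, hp.activePair_eq hl]
  have h := hp.2 _ hw
  have h1 : ‖w.1‖ ^ 2 = ‖p.1‖ ^ 2 + 2 * ⟪w.1 - p.1, p.1⟫ + ‖w.1 - p.1‖ ^ 2 := by
    rw [real_inner_comm, ← norm_add_sq_real, add_sub_cancel]
  have h2 : 0 ≤ 1 / (2 * l) * ‖w.1 - p.1‖ ^ 2 := by positivity
  rw [inner_sub_right, real_inner_smul_right, inner_sub_left] at h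
  have h3 : 1 / l = 2 * (1 / (2 * l)) := by field_simp
  rw [h3] at h
  rw [h1]
  linarith

lemma smoothMax_subgradient {l : ℝ} (hl : 0 < l) {K : Set (E × ℝ)}
    (hK : ∀ x, ∃ p, IsActive l K x p) (x y : E) :
    smoothMax l K x + ⟪(activePair l K x).1, y - x⟫ ≤ smoothMax l K y := by
  obtain ⟨p, hp⟩ := hK x
  obtain ⟨p', hp'⟩ := hK y
  have h := hp'.le_smoothMax hl hp.1
  rw [smoothMax, hp.activePair_eq hl, inner_sub_right]
  linarith

lemma activePair_lipschitz {l : ℝ} (hl : 0 < l) {K : Set (E × ℝ)}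
    (hK : ∀ x, ∃ p, IsActive l K x p) (x y : E) :
    ‖(activePair l K x).1 - (activePair l K y).1‖ ≤ l * ‖x - y‖ := by
  obtain ⟨p, hp⟩ := hK x
  obtain ⟨p', hp'⟩ := hK y
  rw [hp.activePair_eq hl, hp'.activePair_eq hl]
  exact hp.norm_sub_le hl hp'

lemma isActive_convexHull_iff {l : ℝ} {s : Set (E × ℝ)} {x : E} {p : E × ℝ} :
    IsActive l (convexHull ℝ s) x p ↔
      p ∈ convexHull ℝ s ∧ ∀ w ∈ s, ⟪w.1 - p.1, x - (1 / l) • p.1⟫ + w.2 - p.2 ≤ 0 := by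
  refine ⟨fun h => ⟨h.1, fun w hw => h.2 w (subset_convexHull ℝ s hw)⟩, fun h => ⟨h.1, ?_⟩⟩
  have hconv : Convex ℝ {w : E × ℝ | ⟪w.1 - p.1, x - (1 / l) • p.1⟫ + w.2 - p.2 ≤ 0} := by
    intro u hu w hw a b ha hb hab
    simp only [Set.mem_ofPred_eq, inner_sub_left, Prod.fst_add, Prod.smul_fst, Prod.snd_add,
      Prod.smul_snd, smul_eq_mul, inner_add_left, real_inner_smul_left] at hu hw ⊢
    have h1 := mul_nonpos_of_nonneg_of_nonpos ha hu
    have h2 := mul_nonpos_of_nonneg_of_nonpos hb hw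
    obtain rfl : b = 1 - a := by linarith
    linarith
  exact fun w hw => convexHull_min h.2 hconv hw

/-! ### The hard functions -/

/-- The vertex `∑_{k < j} a_k e_k + b_j e_j`. -/
def hardVertex (a b : ℕ → ℝ) (e : ℕ → E) (j : ℕ) : E :=
  ∑ k ∈ Finset.range j, a k • e k + b j • e j

/-- The inner product of the `j`-th vertex with the last one, `j ≤ N`, when `e` is orthonormal and
`a N = b N`. -/
def vertexInner (a b : ℕ → ℝ) (j : ℕ) : ℝ := ∑ k ∈ Finset.range j, a k ^ 2 + b j * a j

/-- The convex hull of the first `M + 1` affine functions: their slopes are the vertices, and their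
constant terms are such that all of them are equally good at the minimizer. -/
def hardHull (μ l : ℝ) (a b : ℕ → ℝ) (e : ℕ → E) (M : ℕ) : Set (E × ℝ) :=
  convexHull ℝ ((fun j => (hardVertex a b e j, (1 / μ + 1 / l) * vertexInner a b j)) '' Set.Iic M)

/-- The function `μ/2 ‖·‖²` plus the smoothed maximum of the first `M + 1` affine functions. -/
def hardFunction (μ l : ℝ) (a b : ℕ → ℝ) (e : ℕ → E) (M : ℕ) (x : E) : ℝ :=
  μ / 2 * ‖x‖ ^ 2 + smoothMax l (hardHull μ l a b e M) x

/-- The vectors `e_0, …, e_N` are orthonormal. -/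
def OrthonormalUpTo (N : ℕ) (e : ℕ → E) : Prop :=
  ∀ j ≤ N, ∀ k ≤ N, ⟪e j, e k⟫ = if j = k then 1 else 0

/-- The relations between the coefficients that make the hard function hide `e_{i+1}, …, e_N` at
points orthogonal to `e_i, …, e_N`. -/
structure HardCoefficients (q : ℝ) (a b : ℕ → ℝ) (N : ℕ) : Prop where
  nonneg : ∀ i < N, 0 ≤ b i
  le : ∀ i < N, a i ≤ b i
  succ : ∀ i < N, b (i + 1) * a (i + 1) = (b i - a i) * (a i - q * b i)
  last : a N = b N

lemma hardHull_congr {μ l : ℝ} {a b : ℕ → ℝ} {e e' : ℕ → E} {M : ℕ} (h : ∀ k ≤ M, e' k = e k) :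
    hardHull μ l a b e' M = hardHull μ l a b e M := by
  rw [hardHull, hardHull]
  congr 1
  refine Set.image_congr fun j hj => ?_
  have hj' : j ≤ M := hj
  have : hardVertex a b e' j = hardVertex a b e j := by
    rw [hardVertex, hardVertex, h j hj']
    congr 1
    refine Finset.sum_congr rfl fun k hk => ?_
    rw [h k ((Finset.mem_range.1 hk).le.trans hj')]
  rw [this]

lemma exists_isActive_hardHull {μ l : ℝ} (hl : 0 < l) (a b : ℕ → ℝ) (e : ℕ → E) (M : ℕ) (x : E) :
    ∃ p, IsActive l (hardHull μ l a b e M) x p := by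
  have hcompact : IsCompact (hardHull μ l a b e M) :=
    Set.Finite.isCompact_convexHull ℝ ((Set.finite_Iic M).image _)
  have hne : (hardHull μ l a b e M).Nonempty :=
    ⟨_, subset_convexHull ℝ _ (Set.mem_image_of_mem _ (Set.mem_Iic.2 le_rfl))⟩
  exact exists_isActive hl hcompact (convex_convexHull ℝ _) hne x

lemma isSmoothStronglyConvex_hardFunction [CompleteSpace E] {μ l : ℝ} (hμ : 0 ≤ μ) (hl : 0 < l)
    (a b : ℕ → ℝ) (e : ℕ → E) (M : ℕ) :
    IsSmoothStronglyConvex μ (μ + l) (hardFunction μ l a b e M) :=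
  isSmoothStronglyConvex_of_subgradient hμ
    (smoothMax_subgradient hl (exists_isActive_hardHull hl a b e M))
    (activePair_lipschitz hl (exists_isActive_hardHull hl a b e M))

lemma gradient_hardFunction [CompleteSpace E] {μ l : ℝ} (hμ : 0 ≤ μ) (hl : 0 < l)
    (a b : ℕ → ℝ) (e : ℕ → E) (M : ℕ) (x : E) :
    gradient (hardFunction μ l a b e M) x =
      μ • x + (activePair l (hardHull μ l a b e M) x).1 :=
  (hasGradientAt_of_subgradient hμ
    (smoothMax_subgradient hl (exists_isActive_hardHull hl a b e M))
    (activePair_lipschitz hl (exists_isActive_hardHull hl a b e M)) x).gradient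

lemma inner_hardVertex (a b : ℕ → ℝ) (e : ℕ → E) (j : ℕ) (z : E) :
    ⟪hardVertex a b e j, z⟫ =
      ∑ k ∈ Finset.range j, a k * ⟪e k, z⟫ + b j * ⟪e j, z⟫ := by
  rw [hardVertex, inner_add_left, sum_inner, real_inner_smul_left]
  simp only [real_inner_smul_left]

lemma OrthonormalUpTo.inner_hardVertex {N : ℕ} {e : ℕ → E} (he : OrthonormalUpTo N e)
    (a b : ℕ → ℝ) {m j : ℕ} (hm : m ≤ N) (hj : j ≤ N) :
    ⟪e m, hardVertex a b e j⟫ = if m < j then a m else if m = j then b j else 0 := by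
  rw [real_inner_comm, _root_.inner_hardVertex]
  have h1 : ∑ k ∈ Finset.range j, a k * ⟪e k, e m⟫ =
      ∑ k ∈ Finset.range j, if k = m then a k else 0 :=
    Finset.sum_congr rfl fun k hk => by
      rw [he k ((Finset.mem_range.1 hk).le.trans hj) m hm, mul_ite, mul_one, mul_zero]
  rw [h1, he j hj m hm, Finset.sum_ite_eq']
  simp only [Finset.mem_range]
  rcases lt_trichotomy m j with h | h | h
  · simp [h, h.ne']
  · simp [h]
  · simp [h.not_gt, h.ne, h.ne']

lemma OrthonormalUpTo.inner_hardVertex_last {N : ℕ} {e : ℕ → E} (he : OrthonormalUpTo N e)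
    {a b : ℕ → ℝ} (hlast : a N = b N) {j : ℕ} (hj : j ≤ N) :
    ⟪hardVertex a b e j, hardVertex a b e N⟫ = vertexInner a b j := by
  have h : ∀ k ≤ N, ⟪e k, hardVertex a b e N⟫ = a k := fun k hk => by
    rw [he.inner_hardVertex a b hk le_rfl]
    rcases hk.lt_or_eq with h | rfl
    · simp [h]
    · simp [hlast]
  rw [_root_.inner_hardVertex, vertexInner, h j hj]
  congr 1
  refine Finset.sum_congr rfl fun k hk => ?_
  rw [h k ((Finset.mem_range.1 hk).le.trans hj), sq]

lemma HardCoefficients.vertexInner_sub {q : ℝ} {a b : ℕ → ℝ} {N : ℕ}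
    (h : HardCoefficients q a b N) {i : ℕ} (hi : i < N) :
    vertexInner a b i - vertexInner a b (i + 1) = q * (b i * (b i - a i)) := by
  rw [vertexInner, vertexInner, Finset.sum_range_succ, h.succ i hi]
  ring

lemma HardCoefficients.le_vertexInner_sub {q : ℝ} (hq : 0 ≤ q) {a b : ℕ → ℝ} {N : ℕ}
    (h : HardCoefficients q a b N) {i j : ℕ} (hij : i < j) (hj : j ≤ N) :
    q * (b i * (b i - a i)) ≤ vertexInner a b i - vertexInner a b j := by
  induction j, hij using Nat.le_induction with
  | base => exact (h.vertexInner_sub hj).ge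
  | succ j hij ih =>
    have h1 := h.vertexInner_sub hj
    have h2 := ih (Nat.le_of_succ_le hj)
    have h3 : 0 ≤ q * (b j * (b j - a j)) :=
      mul_nonneg hq (mul_nonneg (h.nonneg j hj) (sub_nonneg.2 (h.le j hj)))
    linarith

/-- At a point orthogonal to `e_i, …, e_N` the hard function only sees its first `i + 1` affine
pieces: for `j > i`, the `j`-th slope exceeds the `i`-th one by `(a_i - b_i) e_i` plus terms in
later directions, and its constant term is smaller by enough to keep it inactive. -/
lemma IsActive.of_orthogonal {μ l : ℝ} (hμ : 0 < μ) (hl : 0 < l) {a b : ℕ → ℝ} {N : ℕ}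
    (h : HardCoefficients (μ / (μ + l)) a b N) {e : ℕ → E} (he : OrthonormalUpTo N e)
    {i : ℕ} (hi : i < N) {x : E} (hx : ∀ k, i ≤ k → k ≤ N → ⟪e k, x⟫ = 0) {p : E × ℝ}
    (hp : IsActive l (hardHull μ l a b e i) x p) : IsActive l (hardHull μ l a b e N) x p := by
  have hcoord : ∀ w ∈ hardHull μ l a b e i,
      ⟪e i, w.1⟫ ≤ b i ∧ ∀ k, i < k → k ≤ N → ⟪e k, w.1⟫ = 0 := by
    intro w hw
    have hconv : Convex ℝ {w : E × ℝ | ⟪e i, w.1⟫ ≤ b i ∧ ∀ k, i < k → k ≤ N → ⟪e k, w.1⟫ = 0} := by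
      rintro u ⟨hu, hu'⟩ w ⟨hw, hw'⟩ s t hs ht hst
      refine ⟨?_, fun k hk hk' => ?_⟩
      · rw [Prod.fst_add, Prod.smul_fst, Prod.smul_fst, inner_add_right, real_inner_smul_right,
          real_inner_smul_right]
        have h1 := mul_le_mul_of_nonneg_left hu hs
        have h2 := mul_le_mul_of_nonneg_left hw ht
        obtain rfl : t = 1 - s := by linarith
        linarith
      · rw [Prod.fst_add, Prod.smul_fst, Prod.smul_fst, inner_add_right, real_inner_smul_right,
          real_inner_smul_right, hu' k hk hk', hw' k hk hk', mul_zero, mul_zero, add_zero]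
    refine convexHull_min ?_ hconv hw
    rintro _ ⟨j, hj, rfl⟩
    have hj' : j ≤ i := hj
    refine ⟨?_, fun k hk hk' => ?_⟩
    · rw [he.inner_hardVertex a b hi.le (hj'.trans hi.le), if_neg hj'.not_gt]
      split_ifs with hij
      · rw [hij]
      · exact h.nonneg i hi
    · rw [he.inner_hardVertex a b hk' (hj'.trans hi.le), if_neg (by omega), if_neg (by omega)]
  rw [hardHull, isActive_convexHull_iff]
  refine ⟨convexHull_mono (Set.image_mono (Set.Iic_subset_Iic.2 hi.le)) hp.1, ?_⟩
  rintro _ ⟨j, hj, rfl⟩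
  have hj' : j ≤ N := hj
  rcases le_or_gt j i with hji | hij
  · exact hp.2 _ (subset_convexHull ℝ _ ⟨j, hji, rfl⟩)
  have h1 := hp.2 _ (subset_convexHull ℝ _ ⟨i, le_refl i, rfl⟩)
  obtain ⟨hpi, hpk⟩ := hcoord p hp.1
  set z := x - (1 / l) • p.1 with hz
  have hzi : ⟪e i, z⟫ = -(1 / l * ⟪e i, p.1⟫) := by
    rw [hz, inner_sub_right, real_inner_smul_right, hx i le_rfl hi.le, zero_sub]
  have hzk : ∀ k, i < k → k ≤ N → ⟪e k, z⟫ = 0 := fun k hk hk' => by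
    rw [hz, inner_sub_right, real_inner_smul_right, hx k hk.le hk', hpk k hk hk', mul_zero,
      sub_zero]
  have hvj : ⟪hardVertex a b e j, z⟫ =
      ∑ k ∈ Finset.range i, a k * ⟪e k, z⟫ + a i * ⟪e i, z⟫ := by
    rw [inner_hardVertex, hzk j hij hj', mul_zero, add_zero, ← Finset.sum_range_succ]
    refine (Finset.sum_subset (Finset.range_mono hij) fun k hk hk' => ?_).symm
    rw [Finset.mem_range] at hk hk'
    rw [hzk k (by omega) (by omega), mul_zero]
  have hvi := inner_hardVertex a b e i z
  have hgap := h.le_vertexInner_sub (by positivity) hij hj'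
  have hgap' := mul_le_mul_of_nonneg_left hgap (show 0 ≤ 1 / μ + 1 / l by positivity)
  have e1 : (1 / μ + 1 / l) * (μ / (μ + l) * (b i * (b i - a i))) =
      1 / l * (b i * (b i - a i)) := by
    field_simp
    ring
  have h2 : 1 / l * (⟪e i, p.1⟫ * (b i - a i)) ≤ 1 / l * (b i * (b i - a i)) :=
    mul_le_mul_of_nonneg_left
      (mul_le_mul_of_nonneg_right hpi (sub_nonneg.2 (h.le i hi))) (by positivity)
  simp only [inner_sub_left] at h1 ⊢
  rw [hvj]
  rw [hvi] at h1
  rw [hzi] at h1 ⊢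
  linarith

/-- The oracle's answer at a point orthogonal to `e_i, …, e_N` reveals only `e_0, …, e_i`. -/
lemma firstOrderOracle_hardFunction [CompleteSpace E] {μ l : ℝ} (hμ : 0 < μ) (hl : 0 < l)
    {a b : ℕ → ℝ} {N : ℕ} (h : HardCoefficients (μ / (μ + l)) a b N) {e e' : ℕ → E}
    (he : OrthonormalUpTo N e') {i : ℕ} (hi : i < N) (hee' : ∀ k ≤ i, e' k = e k)
    {x : E} (hx : ∀ k, i ≤ k → k ≤ N → ⟪e' k, x⟫ = 0) :
    firstOrderOracle (hardFunction μ l a b e' N) x =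
      firstOrderOracle (hardFunction μ l a b e i) x := by
  obtain ⟨p, hp⟩ := exists_isActive_hardHull (μ := μ) hl a b e i x
  have hp' : IsActive l (hardHull μ l a b e' N) x p := by
    rw [← hardHull_congr hee'] at hp
    exact hp.of_orthogonal hμ hl h he hi hx
  rw [firstOrderOracle, firstOrderOracle, gradient_hardFunction hμ.le hl,
    gradient_hardFunction hμ.le hl, hardFunction, hardFunction, smoothMax, smoothMax,
    hp.activePair_eq hl, hp'.activePair_eq hl]

/-- The last piece is active at `x = -p_N / μ`, where the gradient `μ x + p_N` of the hard function
therefore vanishes. -/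
lemma isActive_hardHull_last {μ l : ℝ} {a b : ℕ → ℝ} {N : ℕ} (hlast : a N = b N) {e : ℕ → E}
    (he : OrthonormalUpTo N e) :
    IsActive l (hardHull μ l a b e N) (-(1 / μ) • hardVertex a b e N)
      (hardVertex a b e N, (1 / μ + 1 / l) * vertexInner a b N) := by
  rw [hardHull, isActive_convexHull_iff]
  refine ⟨subset_convexHull ℝ _ ⟨N, le_refl N, rfl⟩, ?_⟩
  rintro _ ⟨j, hj, rfl⟩
  refine le_of_eq ?_
  have e1 : -(1 / μ) • hardVertex a b e N - (1 / l) • hardVertex a b e N =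
      -(1 / μ + 1 / l) • hardVertex a b e N := by module
  rw [e1, real_inner_smul_right, inner_sub_left, he.inner_hardVertex_last hlast hj,
    he.inner_hardVertex_last hlast le_rfl]
  ring

lemma mem_solutionSet_hardFunction {μ l : ℝ} (hμ : 0 < μ) (hl : 0 < l) {a b : ℕ → ℝ} {N : ℕ}
    (hlast : a N = b N) {e : ℕ → E} (he : OrthonormalUpTo N e) :
    -(1 / μ) • hardVertex a b e N ∈ solutionSet (hardFunction μ l a b e N) := by
  intro y _
  have hp := isActive_hardHull_last (μ := μ) (l := l) hlast he
  have h := smoothMax_subgradient hl (exists_isActive_hardHull (μ := μ) hl a b e N)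
    (-(1 / μ) • hardVertex a b e N) y
  rw [hp.activePair_eq hl] at h
  obtain ⟨x, hx⟩ : ∃ x, x = -(1 / μ) • hardVertex a b e N := ⟨_, rfl⟩
  have hv : hardVertex a b e N = -(μ • x) := by
    rw [hx, smul_smul, ← neg_smul]
    field_simp
    simp
  rw [← hx] at h ⊢
  rw [hv, inner_neg_left, real_inner_smul_left] at h
  have h1 : ‖y‖ ^ 2 = ‖x‖ ^ 2 + 2 * ⟪x, y - x⟫ + ‖y - x‖ ^ 2 := by
    rw [← norm_add_sq_real, add_sub_cancel]
  have h2 : 0 ≤ μ * ‖y - x‖ ^ 2 := by positivity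
  simp only [Set.mem_ofPred_eq, hardFunction]
  rw [h1]
  linarith

/-! ### The coefficients of the hard functions -/

/-- The products `a_i b_i` of the coefficients of the hard functions, up to scaling. The ratios
`a_i / b_i` are `q δ_i`, which is the choice that maximizes the lower bound. -/
def hardProduct (q : ℝ) : ℕ → ℝ
  | 0 => 1
  | i + 1 => (1 - q * itemDelta q i) * (q * itemDelta q i - q) / (q * itemDelta q i) *
      hardProduct q i

lemma hardRatio_bounds {q : ℝ} (hq : 0 < q) (hq1 : q < 1) (i : ℕ) :
    q < q * itemDelta q i ∧ q * itemDelta q i < 1 := by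
  obtain ⟨r, s, hr, hs, -, -, -, -, hδ⟩ := exists_itemA_succ_eq hq.le hq1 i
  have hD : 0 < r + q * s := by positivity
  rw [hδ, mul_div_assoc', lt_div_iff₀ hD, div_lt_one hD]
  constructor <;> nlinarith [mul_pos hq hs]

lemma hardProduct_pos {q : ℝ} (hq : 0 < q) (hq1 : q < 1) : ∀ i, 0 < hardProduct q i
  | 0 => one_pos
  | i + 1 => by
    obtain ⟨h1, h2⟩ := hardRatio_bounds hq hq1 i
    have := hardProduct_pos hq hq1 i
    rw [hardProduct]
    refine mul_pos (div_pos (mul_pos ?_ ?_) ?_) this <;> linarith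

/-- With `a_k = q δ_k b_k`, the left-hand side is `∑_{k < i} a_k²`. -/
lemma sum_hardProduct {q : ℝ} (hq : 0 < q) (hq1 : q < 1) (i : ℕ) :
    ∑ k ∈ Finset.range i, q * itemDelta q k * hardProduct q k =
      q * itemA q i * hardProduct q i := by
  induction i with
  | zero => simp [itemA]
  | succ i ih =>
    obtain ⟨r, s, hr, hs, hr2, hs2, hA, -, hδ⟩ := exists_itemA_succ_eq hq.le hq1 i
    have hq' : 1 - q ≠ 0 := by linarith
    have hD : 0 < r + q * s := by positivity
    rw [Finset.sum_range_succ, ih, hardProduct, hA, hδ]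
    have h1 : 1 - q * ((r + s) / (r + q * s)) = (1 - q) * r / (r + q * s) := by
      field_simp; ring
    have h2 : q * ((r + s) / (r + q * s)) - q = q * (1 - q) * s / (r + q * s) := by
      field_simp; ring
    have h3 : itemA q i = (s ^ 2 - r ^ 2) / (1 - q) := by
      rw [eq_div_iff hq']
      linear_combination hr2 - hs2
    rw [h1, h2, h3]
    field_simp
    have h4 : 1 - q = r ^ 2 - q * s ^ 2 := by linear_combination q * hs2 - hr2
    linear_combination hardProduct q i * (r + s) * h4

/-- Hard coefficients for which `‖p_N‖ = C` and the last coordinate of `p_N` is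
`C / √(1 + q A_N)`. -/
lemma exists_hardCoefficients {q : ℝ} (hq : 0 < q) (hq1 : q < 1) (N : ℕ) {C : ℝ} (hC : 0 < C) :
    ∃ a b : ℕ → ℝ, HardCoefficients q a b N ∧ vertexInner a b N = C ^ 2 ∧
      b N = C / √(1 + q * itemA q N) := by
  have hA := itemA_nonneg hq.le N
  have hB : 0 < 1 + q * itemA q N := by positivity
  have hg := hardProduct_pos hq hq1
  -- The scaling makes `a_N b_N = b_N ^ 2` equal to `C ^ 2 / (1 + q A_N)`.
  set t := C ^ 2 / (1 + q * itemA q N) / hardProduct q N with ht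
  have ht0 : 0 < t := div_pos (by positivity) (hg N)
  set ρ : ℕ → ℝ := fun i => if i < N then q * itemDelta q i else 1 with hρ
  have hρi : ∀ i, i < N → ρ i = q * itemDelta q i := fun i hi => if_pos hi
  have hρN : ρ N = 1 := if_neg (lt_irrefl N)
  have hρ0 : ∀ i, 0 < ρ i := fun i => by
    by_cases hi : i < N
    · rw [hρi i hi]; exact hq.trans (hardRatio_bounds hq hq1 i).1
    · simp only [hρ, if_neg hi, zero_lt_one]
  have hb0 : ∀ i, 0 ≤ √(t * hardProduct q i / ρ i) := fun i => Real.sqrt_nonneg _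
  have hb2 : ∀ i, √(t * hardProduct q i / ρ i) ^ 2 = t * hardProduct q i / ρ i := fun i =>
    Real.sq_sqrt (div_pos (mul_pos ht0 (hg i)) (hρ0 i)).le
  have hab : ∀ i, √(t * hardProduct q i / ρ i) * (ρ i * √(t * hardProduct q i / ρ i)) =
      t * hardProduct q i := fun i => by
    rw [mul_left_comm, ← sq, hb2, mul_div_cancel₀ _ (hρ0 i).ne']
  refine ⟨fun i => ρ i * √(t * hardProduct q i / ρ i), fun i => √(t * hardProduct q i / ρ i),
    ⟨fun i _ => hb0 i, fun i hi => ?_, fun i hi => ?_, ?_⟩, ?_, ?_⟩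
  · have := (hardRatio_bounds hq hq1 i).2
    rw [← hρi i hi] at this
    exact mul_le_of_le_one_left (hb0 i) this.le
  · have h0 := hρ0 i
    have : ∀ b : ℝ, (b - ρ i * b) * (ρ i * b - q * b) = (1 - ρ i) * (ρ i - q) * b ^ 2 :=
      fun b => by ring
    simp only [this]
    rw [hab, hb2, hardProduct, ← hρi i hi]
    field_simp
  · simp only [hρN, one_mul]
  · have hsum : ∑ k ∈ Finset.range N, (ρ k * √(t * hardProduct q k / ρ k)) ^ 2 =
        t * (q * itemA q N * hardProduct q N) := by
      rw [← sum_hardProduct hq hq1, Finset.mul_sum]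
      refine Finset.sum_congr rfl fun k hk => ?_
      have := (hρ0 k).ne'
      rw [mul_pow, hb2, ← hρi k (Finset.mem_range.1 hk)]
      field_simp
    rw [vertexInner, hsum, hab, ht]
    have := (hg N).ne'
    field_simp
    ring
  · simp only [hρN, div_one]
    rw [ht, div_mul_cancel₀ _ (hg N).ne', Real.sqrt_div' _ hB.le, Real.sqrt_sq hC.le]

/-! ### The resisting oracle -/

lemma exists_unit_orthogonal [FiniteDimensional ℝ E] (W : Submodule ℝ E)
    (hW : Module.finrank ℝ W < Module.finrank ℝ E) :
    ∃ u : E, ‖u‖ = 1 ∧ ∀ w ∈ W, ⟪u, w⟫ = 0 := by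
  have hne : Wᗮ ≠ ⊥ := fun h => by
    have := W.finrank_add_finrank_orthogonal
    rw [h, finrank_bot] at this
    omega
  obtain ⟨v, hv, hv0⟩ := Submodule.exists_mem_ne_zero_of_ne_bot hne
  refine ⟨(‖v‖⁻¹ : ℝ) • v, norm_smul_inv_norm hv0, fun w hw => ?_⟩
  rw [real_inner_smul_left, real_inner_comm, (Submodule.mem_orthogonal W v).1 hv w hw, mul_zero]

lemma finrank_sup_span_singleton_le [FiniteDimensional ℝ E] (W : Submodule ℝ E) (y : E) :
    Module.finrank ℝ ↥(W ⊔ ℝ ∙ y) ≤ Module.finrank ℝ W + 1 :=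
  (Submodule.finrank_add_le_finrank_add_finrank _ _).trans
    (Nat.add_le_add_left ((finrank_span_le_card {y}).trans (by simp)) _)

/-- The adversary argument. The oracle `O N e` depends on the vectors `e_0, …, e_N`, but at a point
orthogonal to `e_i, …, e_N` its answer depends only on `e_0, …, e_i`. The adversary chooses `e_i`
when the `i`-th query is made, orthogonal to all points queried so far and to `e_0, …, e_{i-1}`;
the subspace `V` contains these. The last vector is orthogonal to `V`, and its sign is chosen
after the output of the method is known, which saves one dimension. -/
lemma exists_orthonormal_run_inner_nonneg [FiniteDimensional ℝ E] {N : ℕ}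
    (hN : 2 * N + 1 ≤ Module.finrank ℝ E) (O : ℕ → (ℕ → E) → E → ℝ × E)
    (hO : ∀ (e e' : ℕ → E) (i : ℕ) (y : E), OrthonormalUpTo N e' → i < N →
      (∀ k ≤ i, e' k = e k) → (∀ k, i ≤ k → k ≤ N → ⟪e' k, y⟫ = 0) → O N e' y = O i e y)
    (n : ℕ) : ∀ (P : FirstOrderProc E n) (i : ℕ) (e : ℕ → E) (V : Submodule ℝ E), i + n = N →
    Module.finrank ℝ V ≤ 2 * i → (∀ k < i, e k ∈ V) →
    (∀ j < i, ∀ k < i, ⟪e j, e k⟫ = if j = k then (1 : ℝ) else 0) →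
    ∃ e' : ℕ → E, (∀ k < i, e' k = e k) ∧ OrthonormalUpTo N e' ∧
      (∀ k, i ≤ k → k ≤ N → ∀ y ∈ V, ⟪e' k, y⟫ = 0) ∧ 0 ≤ ⟪e' N, P.run (O N e')⟫ := by
  -- Adding a vector to the orthonormal vectors chosen so far.
  have hupdate : ∀ (i : ℕ) (e : ℕ → E) (u : E) (V : Submodule ℝ E), (∀ k < i, e k ∈ V) →
      (∀ j < i, ∀ k < i, ⟪e j, e k⟫ = if j = k then (1 : ℝ) else 0) → ‖u‖ = 1 →
      (∀ w ∈ V, ⟪u, w⟫ = 0) → ∀ j < i + 1, ∀ k < i + 1,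
      ⟪Function.update e i u j, Function.update e i u k⟫ = if j = k then (1 : ℝ) else 0 := by
    intro i e u V heV he hu huV j hj k hk
    rcases (Nat.lt_succ_iff_lt_or_eq.1 hj) with hj | rfl <;>
      rcases (Nat.lt_succ_iff_lt_or_eq.1 hk) with hk | rfl
    · rw [Function.update_of_ne hj.ne, Function.update_of_ne hk.ne, he j hj k hk]
    · rw [Function.update_of_ne hj.ne, Function.update_self, real_inner_comm,
        huV _ (heV j hj), if_neg hj.ne]
    · rw [Function.update_of_ne hk.ne, Function.update_self, huV _ (heV k hk), if_neg hk.ne']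
    · rw [Function.update_self, real_inner_self_eq_norm_sq, hu, one_pow, if_pos rfl]
  induction n with
  | zero =>
    intro P i e V hi hV heV he
    obtain rfl : i = N := hi
    cases P with
    | output ξ =>
    obtain ⟨u, hu, huV⟩ := exists_unit_orthogonal V (by omega)
    obtain ⟨u', hu', hu'V, hu'ξ⟩ : ∃ u' : E, ‖u'‖ = 1 ∧ (∀ w ∈ V, ⟪u', w⟫ = 0) ∧ 0 ≤ ⟪u', ξ⟫ := by
      rcases le_total 0 ⟪u, ξ⟫ with h | h
      · exact ⟨u, hu, huV, h⟩
      · refine ⟨-u, by rwa [norm_neg], fun w hw => ?_, ?_⟩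
        · rw [inner_neg_left, huV w hw, neg_zero]
        · rw [inner_neg_left]; linarith
    refine ⟨Function.update e i u', fun k hk => Function.update_of_ne hk.ne _ _, ?_, ?_, ?_⟩
    · intro j hj k hk
      exact hupdate i e u' V heV he hu' hu'V j (by omega) k (by omega)
    · intro k hk hk' y hy
      obtain rfl : k = i := le_antisymm hk' hk
      rw [Function.update_self, hu'V y hy]
    · rwa [Function.update_self, FirstOrderProc.run]
  | succ n ih =>
    intro P i e V hi hV heV he
    -- One query at `y`, or none, in which case `y` is irrelevant.
    have key : ∀ (y : E) (P' : (ℕ → E) → FirstOrderProc E n),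
        (∀ e₁ e₂ : ℕ → E, OrthonormalUpTo N e₂ → (∀ k ≤ i, e₂ k = e₁ k) →
          (∀ k, i ≤ k → k ≤ N → ⟪e₂ k, y⟫ = 0) → P.run (O N e₂) = (P' e₁).run (O N e₂)) →
        ∃ e' : ℕ → E, (∀ k < i, e' k = e k) ∧ OrthonormalUpTo N e' ∧
          (∀ k, i ≤ k → k ≤ N → ∀ y ∈ V, ⟪e' k, y⟫ = 0) ∧ 0 ≤ ⟪e' N, P.run (O N e')⟫ := by
      intro y P' hP'
      have hVy := finrank_sup_span_singleton_le V y
      obtain ⟨u, hu, huV⟩ := exists_unit_orthogonal (V ⊔ ℝ ∙ y) (by omega)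
      have hVyu := finrank_sup_span_singleton_le (V ⊔ ℝ ∙ y) u
      have hy : y ∈ V ⊔ ℝ ∙ y := (le_sup_right : ℝ ∙ y ≤ _) (Submodule.mem_span_singleton_self y)
      have hupd := hupdate i e u (V ⊔ ℝ ∙ y) (fun k hk => (le_sup_left : V ≤ _) (heV k hk)) he
        hu huV
      set e₁ := Function.update e i u with he₁
      have hei : e₁ i = u := Function.update_self _ _ _
      have hek : ∀ k < i, e₁ k = e k := fun k hk => Function.update_of_ne hk.ne _ _
      obtain ⟨e', h1, h2, h3, h4⟩ := ih (P' e₁) (i + 1) e₁ (V ⊔ ℝ ∙ y ⊔ ℝ ∙ u) (by omega) (by omega)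
        (fun k hk => by
          rcases (Nat.lt_succ_iff_lt_or_eq.1 hk) with hk | rfl
          · rw [hek k hk]
            exact (le_sup_left : V ⊔ ℝ ∙ y ≤ _) ((le_sup_left : V ≤ _) (heV k hk))
          · rw [hei]
            exact (le_sup_right : ℝ ∙ u ≤ _) (Submodule.mem_span_singleton_self u)) hupd
      have hort : ∀ k, i ≤ k → k ≤ N → ∀ w ∈ V ⊔ ℝ ∙ y, ⟪e' k, w⟫ = 0 := fun k hk hk' w hw => by
        rcases hk.lt_or_eq with hk | rfl
        · exact h3 k hk hk' w ((le_sup_left : V ⊔ ℝ ∙ y ≤ _) hw)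
        · rw [h1 i (Nat.lt_succ_self i), hei, huV w hw]
      refine ⟨e', fun k hk => (h1 k (by omega)).trans (hek k hk), h2,
        fun k hk hk' w hw => hort k hk hk' w ((le_sup_left : V ≤ _) hw), ?_⟩
      rwa [hP' e₁ e' h2 (fun k hk => h1 k (by omega)) fun k hk hk' => hort k hk hk' y hy]
    cases P with
    | output ξ =>
      exact key 0 (fun _ => .output ξ) fun _ _ _ _ _ => by simp only [FirstOrderProc.run]
    | query y next =>
      refine key y (fun e₁ => next (O i e₁ y).1 (O i e₁ y).2) fun e₁ e₂ h1 h2 h3 => ?_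
      rw [FirstOrderProc.run, hO e₁ e₂ i y h1 (by omega) h2 h3]

/-! ### The lower bound -/

lemma le_minimaxError [FiniteDimensional ℝ E] {μ L R : ℝ} (hμ : 0 < μ) (hμL : μ < L)
    (hR : 0 < R) {N : ℕ} (hN : 2 * N + 1 ≤ Module.finrank ℝ E) :
    ENNReal.ofReal (R / √(1 + μ / L * itemA (μ / L) N)) ≤
      minimaxError (problemClass E μ L R) N := by
  have hL : 0 < L := hμ.trans hμL
  obtain ⟨l, hl, rfl⟩ : ∃ l, 0 < l ∧ L = μ + l := ⟨L - μ, by linarith, by ring⟩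
  obtain ⟨a, b, hab, hC, hbN⟩ := exists_hardCoefficients (div_pos hμ hL)
    ((div_lt_one hL).2 hμL) N (mul_pos hμ hR)
  refine le_iInf fun A => ?_
  obtain ⟨e, -, he, -, hrun⟩ := exists_orthonormal_run_inner_nonneg hN
    (fun i e => firstOrderOracle (hardFunction μ l a b e i))
    (fun e e' i y he' hi hee' hy =>
      firstOrderOracle_hardFunction hμ hl hab he' hi hee' hy) N (A 0) 0 0 ⊥ (zero_add N)
    (by simp) (by simp) (by simp)
  have hf := isSmoothStronglyConvex_hardFunction hμ.le hl a b e N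
  have hxs := mem_solutionSet_hardFunction hμ hl hab.last he
  have hnorm : ‖-(1 / μ) • hardVertex a b e N‖ = R := by
    have h1 : ‖hardVertex a b e N‖ = μ * R := by
      rw [norm_eq_sqrt_real_inner, he.inner_hardVertex_last hab.last le_rfl, hC,
        Real.sqrt_sq (mul_pos hμ hR).le]
    rw [norm_smul, h1, norm_neg, Real.norm_of_nonneg (by positivity)]
    field_simp
  have hmem : (hardFunction μ l a b e N, (0 : E)) ∈ problemClass E μ (μ + l) R :=
    ⟨hf, _, hxs, by rw [sub_zero, hnorm]⟩
  refine le_trans ?_ (le_iSup₂ (f := fun (p : (E → ℝ) × E) (_ : p ∈ problemClass E μ (μ + l) R) =>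
    Metric.infEDist (A.apply p.1 p.2) (solutionSet p.1)) _ hmem)
  refine Metric.le_infEDist.2 fun y hy => ?_
  obtain rfl : -(1 / μ) • hardVertex a b e N = y :=
    (hf.1.strictConvexOn hμ).eq_of_isMinOn hxs hy (Set.mem_univ _) (Set.mem_univ _)
  rw [edist_dist, dist_eq_norm]
  refine ENNReal.ofReal_le_ofReal ?_
  -- The distance is at least the difference of the last coordinates.
  have heN : ‖e N‖ = 1 := by
    rw [norm_eq_sqrt_real_inner, he N le_rfl N le_rfl, if_pos rfl, Real.sqrt_one]
  have h1 := real_inner_le_norm (e N) (A.apply (hardFunction μ l a b e N) 0 -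
    -(1 / μ) • hardVertex a b e N)
  rw [heN, one_mul, inner_sub_right, real_inner_smul_right,
    he.inner_hardVertex a b le_rfl le_rfl, if_neg (lt_irrefl N), if_pos rfl, hbN] at h1
  have h2 : 1 / μ * (μ * R / √(1 + μ / (μ + l) * itemA (μ / (μ + l)) N)) =
      R / √(1 + μ / (μ + l) * itemA (μ / (μ + l)) N) := by
    field_simp
  have h3 : 0 ≤ ⟪e N, A.apply (hardFunction μ l a b e N) 0⟫ := hrun
  linarith

end Lower

end

theorem corollaryC (μ L R : ℝ) (hμ : 0 < μ) (hμL : μ < L) (hR : 0 < R) (N : ℕ) :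
    (∀ i : ℕ, 0 ≤ μ / L - (1 - μ / L) * lambdaSeq (μ / L) i ^ 2) ∧
    ENNReal.ofReal (lambdaSeq (μ / L) N * R / √(μ / L)) ≤
      minimaxError (problemClass (EuclideanSpace ℝ (Fin (2 * N + 1))) μ L R) N ∧
    (∀ d : ℕ,
      distEfficiency (itemMethod (EuclideanSpace ℝ (Fin d)) μ L N)
          (problemClass (EuclideanSpace ℝ (Fin d)) μ L R) ≤
        ENNReal.ofReal (lambdaSeq (μ / L) N * R / √(μ / L))) ∧
    minimaxError (problemClass (EuclideanSpace ℝ (Fin (2 * N + 1))) μ L R) N =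
      ENNReal.ofReal (lambdaSeq (μ / L) N * R / √(μ / L)) ∧
    (∀ ε : ℝ, IsLeast {n : ℕ | lambdaSeq (μ / L) n * R / √(μ / L) ≤ ε} N →
      IsOracleComplexity (problemClass (EuclideanSpace ℝ (Fin (2 * N + 1))) μ L R) ε N) := by
  have hL : 0 < L := hμ.trans hμL
  have hq : 0 < μ / L := div_pos hμ hL
  have hq1 : μ / L < 1 := (div_lt_one hL).2 hμL
  have hlower : ∀ n ≤ N, ENNReal.ofReal (lambdaSeq (μ / L) n * R / √(μ / L)) ≤
      minimaxError (problemClass (EuclideanSpace ℝ (Fin (2 * N + 1))) μ L R) n := fun n hn => by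
    rw [lambdaSeq_mul_div hq hq1]
    refine le_minimaxError hμ hμL hR ?_
    rw [finrank_euclideanSpace_fin]
    omega
  have hupper : ∀ d : ℕ, distEfficiency (itemMethod (EuclideanSpace ℝ (Fin d)) μ L N)
      (problemClass (EuclideanSpace ℝ (Fin d)) μ L R) ≤
        ENNReal.ofReal (lambdaSeq (μ / L) N * R / √(μ / L)) := fun d => by
    rw [lambdaSeq_mul_div hq hq1]
    exact distEfficiency_itemMethod_le hμ hμL N
  have heq : minimaxError (problemClass (EuclideanSpace ℝ (Fin (2 * N + 1))) μ L R) N =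
      ENNReal.ofReal (lambdaSeq (μ / L) N * R / √(μ / L)) :=
    le_antisymm ((iInf_le _ _).trans (hupper _)) (hlower N le_rfl)
  refine ⟨lambdaSeq_radicand_nonneg hq hq1, hlower N le_rfl, hupper, heq, fun ε hε => ⟨?_, ?_⟩⟩
  · rw [Set.mem_ofPred_eq, heq]
    exact ENNReal.ofReal_le_ofReal hε.1
  · intro n hn
    by_contra! hnN
    have h1 : ε < lambdaSeq (μ / L) n * R / √(μ / L) := by
      by_contra! h
      exact hnN.not_ge (hε.2 h)
    have hA := itemA_nonneg hq.le n
    have h2 : 0 < lambdaSeq (μ / L) n * R / √(μ / L) := by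
      rw [lambdaSeq_mul_div hq hq1]
      positivity
    exact ((hlower n hnN.le).trans hn).not_gt ((ENNReal.ofReal_lt_ofReal_iff h2).2 h1)
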